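/- A CM field is a number field that is a totally imaginary quadratic extension of a totally real field; a CM field is primitive if none of its proper subfields is a CM field. Let $\Delta(K)$ denote the (signed) discriminant of a number field $K$. Every primitive CM field $K$ with $[K:\mathbb{Q}]=4$ satisfies $\Delta(K)\ge 125$. The bound is attained: $\mathbb{Q}(\zeta_5)$, where $\zeta_5$ is a primitive fifth root of unity, is a primitive CM field of degree $4$ over $\mathbb{Q}$ and $\Delta(\mathbb{Q}(\zeta_5))=125$. -/

import Mathlib

/-- A CM field is primitive if none of its proper subfields is a CM field. -/
structure IsPrimitiveCMField (K : Type*) [Field K] [CharZero K] : Prop where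
  isCMField : NumberField.IsCMField K
  not_isCMField_of_ne_top : ∀ F : Subfield K, F ≠ ⊤ → ¬ NumberField.IsCMField F

/-- A primitive CM field of degree `4` over the rational numbers. -/
structure IsPrimitiveQuarticCMField (K : Type*) [Field K] [NumberField K] : Prop where
  isPrimitiveCMField : IsPrimitiveCMField K
  finrank_eq_four : Module.finrank ℚ K = 4

/-! Let `F` be the maximal real subfield of `K`, a real quadratic field. Since `discr F ^ 2` divides
`discr K > 0`, discriminant at least 12 gives `discr K ≥ 144`; otherwise `discr F` is 5 or 8. Then
`𝓞 F` is principal by Minkowski, so `𝓞 K` has a basis `1, θ` with `θ² = p + tθ`, and `discr K =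
discr F ^ 2 * N(δ)` with `δ = t² + 4p` (`Module.Basis.discr_smulTower_of_sq_eq`). As `δ` is a square
modulo 4 and negative at some real place, small norms are impossible: norm 1 over `ℤ[√2]` by descent
along units, norms 2, 3, 4 over `ℤ[(1 + √5)/2]` by congruences; norm 1 in the latter case
contradicts Minkowski's bound. For `ℚ(ζ₅)` the Galois group is cyclic of order 4, so complex
conjugation lies in every nontrivial subgroup and every proper subfield is real. -/

open NumberField Module

/-! ### Bases of free modules of rank two -/

/-- The change of basis by a matrix of determinant one whose first row is `(a, c)`. -/
theorem Module.Basis.exists_of_bezout {R M : Type*} [CommRing R] [AddCommGroup M] [Module R M]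
    (e : Basis (Fin 2) R M) {a c α β : R} (h : a * α + c * β = 1) :
    ∃ b : Basis (Fin 2) R M, b 0 = a • e 0 + c • e 1 ∧ b 1 = -β • e 0 + α • e 1 := by
  have hli : LinearIndependent R ![a • e 0 + c • e 1, -β • e 0 + α • e 1] := by
    rw [LinearIndependent.pair_iff]
    intro x y hxy
    have he : (x * a - y * β) • e 0 + (x * c + y * α) • e 1 = 0 := by
      rw [← hxy]; module
    have hli : LinearIndependent R ![e 0, e 1] := by
      convert e.linearIndependent using 1
      ext i; fin_cases i <;> rfl
    obtain ⟨h0, h1⟩ := LinearIndependent.pair_iff.mp hli _ _ he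
    constructor
    · linear_combination α * h0 + β * h1 - x * h
    · linear_combination a * h1 - c * h0 - y * h
  have hsp : ⊤ ≤ Submodule.span R (Set.range ![a • e 0 + c • e 1, -β • e 0 + α • e 1]) := by
    rw [← e.span_eq, Submodule.span_le]
    rintro _ ⟨i, rfl⟩
    rw [SetLike.mem_coe, Matrix.range_cons, Matrix.range_cons, Matrix.range_empty, Set.union_empty,
      Set.singleton_union, Submodule.mem_span_pair]
    fin_cases i
    · refine ⟨α, -c, ?_⟩
      calc _ = (a * α + c * β) • e 0 := by module
        _ = _ := by rw [h, one_smul]; rfl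
    · refine ⟨β, a, ?_⟩
      calc _ = (a * α + c * β) • e 1 := by module
        _ = _ := by rw [h, one_smul]; rfl
  exact ⟨Basis.mk hli hsp, by simp, by simp⟩

/-- In an algebra that is free of rank two over a principal ideal domain, the unit is part of
a basis. -/
theorem exists_basis_fin_two_zero_eq_one (R S : Type*) [CommRing R] [IsDomain R]
    [IsPrincipalIdealRing R] [CommRing S] [Algebra R S] [Module.Finite R S] [IsTorsionFree R S]
    (h : finrank R S = 2) : ∃ b : Basis (Fin 2) R S, b 0 = 1 := by
  let e : Basis (Fin 2) R S := finBasisOfFinrankEq R S h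
  have h1 : (1 : S) = e.repr 1 0 • e 0 + e.repr 1 1 • e 1 := by
    rw [← Fin.sum_univ_two (fun i => e.repr 1 i • e i), e.sum_repr]
  obtain ⟨g, hg⟩ := (IsPrincipalIdealRing.principal
    (Ideal.span {e.repr 1 0, e.repr 1 1})).principal
  rw [← Ideal.span] at hg
  have hga : e.repr 1 0 ∈ Ideal.span {g} := hg ▸ Ideal.subset_span (by simp)
  have hgc : e.repr 1 1 ∈ Ideal.span {g} := hg ▸ Ideal.subset_span (by simp)
  obtain ⟨a', ha'⟩ := Ideal.mem_span_singleton.mp hga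
  obtain ⟨c', hc'⟩ := Ideal.mem_span_singleton.mp hgc
  -- The gcd `g` of the coordinates of 1 divides 1 in `S`; taking norms, `g ^ 2` divides 1 in `R`.
  have hgu : IsUnit g := by
    have hprod : (1 : S) = algebraMap R S g * (a' • e 0 + c' • e 1) := by
      rw [← Algebra.smul_def, smul_add, smul_smul, smul_smul, ← ha', ← hc', ← h1]
    have hn := congrArg (Algebra.norm R) hprod
    rw [map_one, map_mul, Algebra.norm_algebraMap_of_basis e, Fintype.card_fin, sq, mul_assoc] at hn
    exact IsUnit.of_mul_eq_one _ hn.symm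
  have htop : (1 : R) ∈ Ideal.span {e.repr 1 0, e.repr 1 1} := by
    rw [hg, Ideal.span_singleton_eq_top.mpr hgu]; trivial
  obtain ⟨α, β, hαβ⟩ := Ideal.mem_span_pair.mp htop
  obtain ⟨b, hb, -⟩ := e.exists_of_bezout (a := e.repr 1 0) (c := e.repr 1 1) (α := α) (β := β)
    (by linear_combination hαβ)
  exact ⟨b, hb.trans h1.symm⟩

/-! ### Trace and discriminant for a basis `1, ω` -/

section QuadraticBasis

variable {R S : Type*} [CommRing R] [CommRing S] [Algebra R S]

theorem Module.Basis.trace_one_of_fin_two (b : Basis (Fin 2) R S) : Algebra.trace R S 1 = 2 := by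
  simpa using Algebra.trace_algebraMap_of_basis b 1

theorem Module.Basis.trace_of_sq_eq (b : Basis (Fin 2) R S) (hb : b 0 = 1) {p t : R} (h : b 1 ^ 2 = p • 1 + t • b 1) :
    Algebra.trace R S (b 1) = t := by
  rw [Algebra.trace_eq_matrix_trace b, Matrix.trace_fin_two, Algebra.leftMulMatrix_eq_repr_mul,
    Algebra.leftMulMatrix_eq_repr_mul, hb, mul_one, ← sq, h, ← hb]
  simp

theorem Module.Basis.exists_sq_eq (b : Basis (Fin 2) R S) (hb : b 0 = 1) : ∃ p t : R, b 1 ^ 2 = p • 1 + t • b 1 :=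
  ⟨b.repr (b 1 ^ 2) 0, b.repr (b 1 ^ 2) 1, by
    conv_lhs => rw [← b.sum_repr (b 1 ^ 2), Fin.sum_univ_two, hb]⟩

theorem Module.Basis.discr_of_sq_eq (b : Basis (Fin 2) R S) (hb : b 0 = 1) {p t : R}
    (h : b 1 ^ 2 = p • 1 + t • b 1) :
    Algebra.discr R b = t ^ 2 + 4 * p := by
  have h1 : Algebra.trace R S 1 = 2 := b.trace_one_of_fin_two
  have ht := b.trace_of_sq_eq hb h
  rw [Algebra.discr_def, Matrix.det_fin_two]
  simp only [Algebra.traceMatrix_apply, Algebra.traceForm_apply, hb, mul_one, one_mul, ← sq, h,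
    map_add, map_smul, h1, ht, smul_eq_mul, one_pow]
  ring

end QuadraticBasis

/-! ### Discriminant of a tower of quadratic extensions -/

section Tower

variable {R S T : Type*} [CommRing R] [CommRing S] [CommRing T] [Algebra R S] [Algebra S T]
  [Algebra R T] [IsScalarTower R S T]

/-- The discriminant of a tower of two quadratic extensions, in terms of the coefficients of the
quadratic equations of the generators. -/
theorem Module.Basis.discr_smulTower_of_sq_eq {b : Basis (Fin 2) R S} {c : Basis (Fin 2) S T}
    (hb : b 0 = 1) (hc : c 0 = 1) {m s p₀ p₁ t₀ t₁ : R} (hb1 : b 1 ^ 2 = m • 1 + s • b 1)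
    (hc1 : c 1 ^ 2 = (p₀ • 1 + p₁ • b 1) • 1 + (t₀ • 1 + t₁ • b 1) • c 1) {u v : R}
    (hu : u = t₀ ^ 2 + m * t₁ ^ 2 + 4 * p₀) (hv : v = 2 * t₀ * t₁ + s * t₁ ^ 2 + 4 * p₁) :
    Algebra.discr R (b.smulTower c) =
      (s ^ 2 + 4 * m) ^ 2 * (u ^ 2 + s * u * v - m * v ^ 2) := by
  have := Module.Free.of_basis b
  have := Module.Free.of_basis c
  have := Module.Finite.of_basis b
  have := Module.Finite.of_basis c
  have hS1 : Algebra.trace R S 1 = 2 := b.trace_one_of_fin_two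
  have hSb : Algebra.trace R S (b 1) = s := b.trace_of_sq_eq hb hb1
  have hT1 : Algebra.trace S T 1 = 2 := c.trace_one_of_fin_two
  have hTc : Algebra.trace S T (c 1) = t₀ • 1 + t₁ • b 1 := c.trace_of_sq_eq hc hc1
  set ω := b 1 with hω
  set θ := c 1 with hθ
  have key (x y z w : R) : Algebra.trace R T ((x • 1 + y • ω) • 1 + (z • 1 + w • ω) • θ) =
      2 * (2 * x + s * y) + (2 * (z * t₀ + m * w * t₁) + s * (z * t₁ + w * t₀ + s * w * t₁)) := by
    rw [← Algebra.trace_trace (S := S), map_add, map_smul, map_smul, hT1, hTc]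
    have : (x • 1 + y • ω) • (2 : S) + (z • 1 + w • ω) • (t₀ • 1 + t₁ • ω) =
        (2 * x + (z * t₀ + m * w * t₁)) • 1 +
          (2 * y + (z * t₁ + w * t₀ + s * w * t₁)) • ω := by
      simp only [Algebra.smul_def, mul_one, map_add, map_mul, map_ofNat] at hb1 ⊢
      linear_combination (algebraMap R S w * algebraMap R S t₁) * hb1
    rw [this, map_add, map_smul, map_smul, hS1, hSb, smul_eq_mul, smul_eq_mul]
    ring
  have e (x : T) {x₀ y₀ z₀ w₀ : R} (h : x = (x₀ • 1 + y₀ • ω) • 1 + (z₀ • 1 + w₀ • ω) • θ) :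
      Algebra.trace R T x = 2 * (2 * x₀ + s * y₀) +
        (2 * (z₀ * t₀ + m * w₀ * t₁) + s * (z₀ * t₁ + w₀ * t₀ + s * w₀ * t₁)) := h ▸ key ..
  replace hb1 : algebraMap S T ω ^ 2 = algebraMap R T m + algebraMap R T s * algebraMap S T ω := by
    simpa [Algebra.smul_def, ← IsScalarTower.algebraMap_apply] using congrArg (algebraMap S T) hb1
  simp only [Algebra.smul_def, mul_one, map_add, map_mul,
    ← IsScalarTower.algebraMap_apply] at hc1 e
  set W := algebraMap S T ω
  set f := algebraMap R T
  have e00 := e 1 (x₀ := 1) (y₀ := 0) (z₀ := 0) (w₀ := 0) (by simp)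
  have e10 := e W (x₀ := 0) (y₀ := 1) (z₀ := 0) (w₀ := 0) (by simp)
  have e20 := e (W * W) (x₀ := m) (y₀ := s) (z₀ := 0) (w₀ := 0)
    (by rw [map_zero]; linear_combination hb1)
  have e01 := e θ (x₀ := 0) (y₀ := 0) (z₀ := 1) (w₀ := 0) (by simp)
  have e11 := e (W * θ) (x₀ := 0) (y₀ := 0) (z₀ := 0) (w₀ := 1) (by simp)
  have e21 := e (W * W * θ) (x₀ := 0) (y₀ := 0) (z₀ := m) (w₀ := s)
    (by rw [map_zero]; linear_combination θ * hb1)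
  have e02 := e (θ * θ) (x₀ := p₀) (y₀ := p₁) (z₀ := t₀) (w₀ := t₁) (by linear_combination hc1)
  have e12 := e (W * (θ * θ)) (x₀ := m * p₁) (y₀ := p₀ + s * p₁) (z₀ := m * t₁)
    (w₀ := t₀ + s * t₁) (by
      simp only [map_add, map_mul]
      linear_combination W * hc1 + (f p₁ + f t₁ * θ) * hb1)
  have e22 := e (W * W * (θ * θ)) (x₀ := m * (p₀ + s * p₁)) (y₀ := m * p₁ + s * (p₀ + s * p₁))
    (z₀ := m * (t₀ + s * t₁)) (w₀ := m * t₁ + s * (t₀ + s * t₁)) (by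
      simp only [map_add, map_mul]
      linear_combination W * W * hc1 + (f p₀ + f t₀ * θ + (f p₁ + f t₁ * θ) * W +
        (f p₁ + f t₁ * θ) * f s) * hb1)
  have hbc (i : Fin 2 × Fin 2) : b.smulTower c i = ![1, W] i.1 * ![1, θ] i.2 := by
    obtain ⟨i, j⟩ := i
    rw [Module.Basis.smulTower_apply, Algebra.smul_def]
    fin_cases i <;> fin_cases j <;> simp [hb, hc, W, ← hω, ← hθ]
  have hdet : Algebra.discr R (b.smulTower c) = Matrix.det
      !![Algebra.trace R T 1, Algebra.trace R T θ, Algebra.trace R T W, Algebra.trace R T (W * θ);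
        Algebra.trace R T θ, Algebra.trace R T (θ * θ), Algebra.trace R T (W * θ),
          Algebra.trace R T (W * (θ * θ));
        Algebra.trace R T W, Algebra.trace R T (W * θ), Algebra.trace R T (W * W),
          Algebra.trace R T (W * W * θ);
        Algebra.trace R T (W * θ), Algebra.trace R T (W * (θ * θ)), Algebra.trace R T (W * W * θ),
          Algebra.trace R T (W * W * (θ * θ))] := by
    rw [Algebra.discr_def, ← Matrix.det_submatrix_equiv_self finProdFinEquiv.symm]
    congr 1
    ext i j
    rw [Matrix.submatrix_apply, Algebra.traceMatrix_apply, Algebra.traceForm_apply, hbc, hbc]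
    fin_cases i <;> fin_cases j <;>
      simp [finProdFinEquiv, Fin.divNat, Fin.modNat] <;> congr 1 <;> ring
  rw [hdet, e00, e10, e20, e01, e11, e21, e02, e12, e22, hu, hv]
  simp only [Matrix.det_succ_row_zero, Fin.sum_univ_succ]
  simp [Fin.succAbove]
  ring

end Tower

/-! ### Arithmetic of the relative discriminant over `ℤ[√2]` and `ℤ[(1 + √5) / 2]` -/

/-- A totally negative element of `ℤ[√2]` of norm one is not a square modulo four. -/
theorem not_square_mod_four_of_neg_of_norm_eq_one (n : ℕ) : ∀ u v : ℤ, v.natAbs ≤ n → u < 0 →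
    u ^ 2 - 2 * v ^ 2 = 1 → ¬ (u % 4 = 1 ∧ v % 4 = 0 ∨ u % 4 = 3 ∧ v % 4 = 2) := by
  induction n with
  | zero =>
    intro u v hv hu h hmod
    obtain rfl : v = 0 := by omega
    have : u = -1 := by nlinarith
    omega
  | succ n ih =>
    have main (u v : ℤ) (hv : v.natAbs ≤ n + 1) (hv0 : 0 < v) (hu : u < 0)
        (h : u ^ 2 - 2 * v ^ 2 = 1) : ¬ (u % 4 = 1 ∧ v % 4 = 0 ∨ u % 4 = 3 ∧ v % 4 = 2) := by
      intro hmod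
      have hv2 : 2 ≤ v := by omega
      have h1 : u < -v := by nlinarith
      -- Multiplication by the unit `3 + 2√2` keeps norm and sign, swaps the two residue classes,
      -- and lowers `v` to `2u + 3v`, which lies in `[0, v)`.
      have h2 : 0 ≤ 3 * v + 2 * u := by nlinarith
      have h3 : 3 * u + 4 * v < 0 := by nlinarith
      exact ih (3 * u + 4 * v) (2 * u + 3 * v) (by omega) h3 (by linear_combination h) (by omega)
    intro u v hv hu h hmod
    rcases lt_trichotomy v 0 with hv0 | hv0 | hv0
    · exact main u (-v) (by omega) (by omega) hu (by linear_combination h) (by omega)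
    · exact ih u v (by omega) hu h hmod
    · exact main u v hv hv0 hu h hmod

/-- Odd norm forces `t₀` odd; then `(t₀ + t₁√2)²` is `1` or `3 + 2√2` modulo 4, according to the
parity of `t₁`. -/
theorem sq_add_two_mul_sq_mod_four {t₀ t₁ p₀ p₁ u v : ℤ} (hu : u = t₀ ^ 2 + 2 * t₁ ^ 2 + 4 * p₀)
    (hv : v = 2 * t₀ * t₁ + 4 * p₁) (h : u ^ 2 - 2 * v ^ 2 = 1) :
    u % 4 = 1 ∧ v % 4 = 0 ∨ u % 4 = 3 ∧ v % 4 = 2 := by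
  rcases Int.even_or_odd' t₀ with ⟨k, rfl | rfl⟩ <;> rcases Int.even_or_odd' t₁ with ⟨l, rfl | rfl⟩
  · exfalso
    have : u ^ 2 = u * (2 * (2 * k ^ 2 + 4 * l ^ 2 + 2 * p₀)) := by rw [sq, hu]; ring
    have h2 : 2 * (u * (2 * k ^ 2 + 4 * l ^ 2 + 2 * p₀) - v ^ 2) = 1 := by linarith
    omega
  · exfalso
    have : u ^ 2 = u * (2 * (2 * k ^ 2 + (2 * l + 1) ^ 2 + 2 * p₀)) := by rw [sq, hu]; ring
    have h2 : 2 * (u * (2 * k ^ 2 + (2 * l + 1) ^ 2 + 2 * p₀) - v ^ 2) = 1 := by linarith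
    omega
  · left
    have h1 : u = 1 + 4 * (k ^ 2 + k + 2 * l ^ 2 + p₀) := by rw [hu]; ring
    have h2 : v = 4 * ((2 * k + 1) * l + p₁) := by rw [hv]; ring
    omega
  · right
    have h1 : u = 3 + 4 * (k ^ 2 + k + 2 * l ^ 2 + 2 * l + p₀) := by rw [hu]; ring
    have h2 : v = 2 + 4 * (2 * k * l + k + l + p₁) := by rw [hv]; ring
    omega

/-- An element of `ℤ[(1 + √5) / 2]` that is a square modulo four does not have norm `2`, `3`
or `4`. -/
theorem norm_golden_notMem_Icc {t₀ t₁ p₀ p₁ u v : ℤ} (hu : u = t₀ ^ 2 + t₁ ^ 2 + 4 * p₀)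
    (hv : v = 2 * t₀ * t₁ + t₁ ^ 2 + 4 * p₁) : u ^ 2 + u * v - v ^ 2 ∉ Set.Icc 2 4 := by
  rintro ⟨h2, h4⟩
  have h3 : u ^ 2 + u * v - v ^ 2 ≠ 3 := by
    intro h
    -- Four times the norm is `(2u + v)² - 5v²`, and 2 is not a square modulo 5.
    have h5 : ((2 * u + v : ℤ) : ZMod 5) ^ 2 = 2 := by
      have : (2 * u + v) ^ 2 = 5 * v ^ 2 + 12 := by linear_combination 4 * h
      rw [← Int.cast_pow, this]
      push_cast
      rw [show (5 : ZMod 5) = 0 from rfl, zero_mul, zero_add]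
      rfl
    revert h5
    generalize ((2 * u + v : ℤ) : ZMod 5) = x
    revert x
    decide
  have heven : Even (u ^ 2 + u * v - v ^ 2) := by
    rcases (by omega : u ^ 2 + u * v - v ^ 2 = 2 ∨ u ^ 2 + u * v - v ^ 2 = 4) with h | h <;>
      rw [h] <;> decide
  -- The norm form is anisotropic modulo 2, as 2 is inert. Evenness then passes from `u, v` to `t₀,
  -- t₁`, so 16 divides the norm.
  have hpar : Even u ∧ Even v := by
    by_contra hcon
    rcases Int.even_or_odd u with hu | hu <;> rcases Int.even_or_odd v with hv | hv <;>
      simp_all [parity_simps, ← Int.not_even_iff_odd]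
  have hpar' : Even t₀ ∧ Even t₁ := by
    have h0 := hpar.1
    have h1 := hpar.2
    rw [hu] at h0
    rw [hv] at h1
    by_contra hcon
    rcases Int.even_or_odd t₀ with hu | hu <;> rcases Int.even_or_odd t₁ with hv | hv <;>
      simp_all [parity_simps, show Even (4 : ℤ) by decide]
  obtain ⟨⟨k, rfl⟩, ⟨l, rfl⟩⟩ := hpar'
  have h16 : u ^ 2 + u * v - v ^ 2 = 16 * ((k ^ 2 + l ^ 2 + p₀) ^ 2 +
      (k ^ 2 + l ^ 2 + p₀) * (2 * k * l + l ^ 2 + p₁) - (2 * k * l + l ^ 2 + p₁) ^ 2) := by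
    rw [hu, hv]; ring
  omega

/-! ### Quartic totally complex fields with a real quadratic subfield -/

namespace NumberField

theorem discr_pos_of_isTotallyReal (F : Type*) [Field F] [NumberField F] [IsTotallyReal F] :
    0 < discr F := by
  rw [← Int.sign_eq_one_iff_pos, sign_discr, IsTotallyReal.nrComplexPlaces_eq_zero, pow_zero]

/-- The ring of integers of a quadratic field has a `ℤ`-basis `1, ω` with `ω ^ 2 = m + s * ω`
and `s` equal to `0` or `1`. -/
theorem exists_basis_ringOfIntegers_of_finrank_eq_two {F : Type*} [Field F] [NumberField F]
    (h : finrank ℚ F = 2) : ∃ (b : Basis (Fin 2) ℤ (𝓞 F)) (m s : ℤ), b 0 = 1 ∧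
      b 1 ^ 2 = m • 1 + s • b 1 ∧ (s = 0 ∨ s = 1) ∧ discr F = s ^ 2 + 4 * m := by
  obtain ⟨e, he⟩ := exists_basis_fin_two_zero_eq_one ℤ (𝓞 F) (by rw [RingOfIntegers.rank, h])
  obtain ⟨p, t, hpt⟩ := e.exists_sq_eq he
  -- Translating the generator by `t / 2` reduces its trace to `t % 2`.
  obtain ⟨b, hb0, hb1⟩ := e.exists_of_bezout (a := 1) (c := 0) (α := 1) (β := t / 2) (by ring)
  rw [he, one_smul, zero_smul, add_zero] at hb0
  rw [he, one_smul] at hb1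
  obtain ⟨m, s, hms, hs⟩ : ∃ m s : ℤ, b 1 ^ 2 = m • 1 + s • b 1 ∧ (s = 0 ∨ s = 1) := by
    refine ⟨p + t * (t / 2) - (t / 2) ^ 2, t - 2 * (t / 2), ?_, by omega⟩
    rw [hb1]
    simp only [zsmul_eq_mul, mul_one] at hpt ⊢
    push_cast
    linear_combination hpt
  exact ⟨b, m, s, hb0, hms, hs, by rw [← discr_eq_discr F b, b.discr_of_sq_eq hb0 hms]⟩

/-- The discriminant of a quadratic field is not a perfect square. -/
theorem discr_ne_sq_of_finrank_eq_two {F : Type*} [Field F] [NumberField F]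
    (h : finrank ℚ F = 2) (k : ℤ) : discr F ≠ k ^ 2 := by
  intro hk
  obtain ⟨b, m, s, hb0, hb1, -, hd⟩ := exists_basis_ringOfIntegers_of_finrank_eq_two h
  have hlin (a : ℤ) : (2 : ℤ) • b 1 + a • b 0 ≠ 0 := by
    intro h0
    have := congrArg (fun x => b.repr x 1) h0
    simp only [map_add, map_smul, Finsupp.add_apply, Finsupp.smul_apply, b.repr_self] at this
    simp at this
  -- If the discriminant is `k²`, the equation of `ω` splits: `(2ω - s)² = k²`.
  have hprod : ((2 : ℤ) • b 1 + (k - s) • b 0) * ((2 : ℤ) • b 1 + (-k - s) • b 0) = 0 := by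
    rw [hb0]
    simp only [zsmul_eq_mul, mul_one] at hb1 ⊢
    have hkm : (k : 𝓞 F) ^ 2 = s ^ 2 + 4 * m := by exact_mod_cast hk.symm.trans hd
    push_cast
    linear_combination 4 * hb1 - hkm
  rcases mul_eq_zero.mp hprod with h0 | h0
  · exact hlin _ h0
  · exact hlin _ h0

/-- The ring of integers of a real quadratic field of discriminant less than `16` is principal. -/
theorem isPrincipalIdealRing_of_finrank_eq_two {F : Type*} [Field F] [NumberField F]
    [IsTotallyReal F] (h : finrank ℚ F = 2) (hd : discr F < 16) :
    IsPrincipalIdealRing (𝓞 F) := by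
  -- For a real quadratic field the bound here is `(2 * 2² / 2!)² = 16`.
  apply RingOfIntegers.isPrincipalIdealRing_of_abs_discr_lt
  rw [IsTotallyReal.nrComplexPlaces_eq_zero, h, abs_of_pos (discr_pos_of_isTotallyReal F)]
  have : ((discr F : ℤ) : ℝ) < 16 := by exact_mod_cast hd
  norm_num [Nat.factorial]
  exact this

/-! ### Totally complex quadratic extensions of number fields -/

section CM

variable {F K : Type*} [Field F] [NumberField F] [Field K] [NumberField K] [Algebra F K]

theorem discr_sq_dvd_discr_of_finrank_eq_two (h : finrank F K = 2) : discr F ^ 2 ∣ discr K := by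
  rw [← Int.natAbs_dvd_natAbs, Int.natAbs_pow,
    natAbs_discr_eq_absNorm_differentIdeal_mul_natAbs_discr_pow F (𝓞 F) K (𝓞 K), h]
  exact dvd_mul_left _ _

theorem discr_pos_of_isTotallyComplex [IsTotallyComplex K] (h : finrank ℚ K = 4) :
    0 < discr K := by
  have := IsTotallyComplex.finrank K
  rw [← Int.sign_eq_one_iff_pos, sign_discr, show InfinitePlace.nrComplexPlaces K = 2 by omega]
  norm_num

/-- Minkowski's bound in degree 4 is `4π⁴/9 ≈ 43.29`. It excludes `discr K = 25`. -/
theorem forty_three_lt_discr_of_isTotallyComplex [IsTotallyComplex K] (h : finrank ℚ K = 4) :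
    43 < discr K := by
  have hm := abs_discr_ge_of_isTotallyComplex K
  rw [h, abs_of_pos (discr_pos_of_isTotallyComplex h)] at hm
  have hpi : (3.14 : ℝ) < Real.pi := Real.pi_gt_d2
  have h43 : (43 : ℝ) < discr K := by
    refine lt_of_lt_of_le ?_ hm
    rw [lt_div_iff₀ (by positivity), div_pow]
    norm_num [Nat.factorial]
    rw [div_mul_eq_mul_div, ← mul_div_assoc, div_lt_iff₀ (by positivity)]
    have : (3.14 : ℝ) ^ 4 < Real.pi ^ 4 := by gcongr
    norm_num at this ⊢
    linarith
  exact_mod_cast h43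

/-- The relative discriminant of a totally complex quadratic extension of a totally real field
is negative at some real embedding. -/
theorem exists_embedding_relative_discr_neg {F K : Type*} [Field F] [Field K] [NumberField K]
    [Algebra F K] [IsTotallyReal F] [IsTotallyComplex K]
    {c : Basis (Fin 2) (𝓞 F) (𝓞 K)} (hc : c 0 = 1) {p t : 𝓞 F}
    (hc1 : c 1 ^ 2 = p • 1 + t • c 1) :
    ∃ φ : F →+* ℝ, φ (t ^ 2 + 4 * p : 𝓞 F) < 0 := by
  obtain ⟨Φ⟩ : Nonempty (K →+* ℂ) := inferInstance
  let hφ := IsTotallyReal.complexEmbedding_isReal (Φ.comp (algebraMap F K))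
  refine ⟨hφ.embedding, ?_⟩
  by_contra! hneg
  have hreal (x : F) : Φ (algebraMap F K x) = (hφ.embedding x : ℂ) :=
    (hφ.coe_embedding_apply x).symm
  have hrealO (x : 𝓞 F) : Φ ((algebraMap (𝓞 F) (𝓞 K) x : 𝓞 K) : K) = (hφ.embedding x : ℂ) := by
    rw [← hreal]; rfl
  -- Here `z² = φ(δ)`. Were this nonnegative, `z`, hence `Φ(θ)`, would be real, and `Φ` would be a
  -- real embedding.
  set z : ℂ := Φ ((2 * c 1 - algebraMap (𝓞 F) (𝓞 K) t : 𝓞 K) : K) with hz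
  have hsq : z ^ 2 = (hφ.embedding (t ^ 2 + 4 * p : 𝓞 F) : ℂ) := by
    rw [hz, ← map_pow, ← hrealO, ← map_pow]
    congr 2
    simp only [Algebra.smul_def, mul_one] at hc1
    simp only [map_add, map_mul, map_pow, map_ofNat]
    linear_combination 4 * hc1
  have him : z.im = 0 := by
    have h1 := congrArg Complex.re hsq
    have h2 := congrArg Complex.im hsq
    simp only [pow_two z, Complex.mul_re, Complex.mul_im, Complex.ofReal_re, Complex.ofReal_im] at h1 h2
    by_contra h0
    have : z.re = 0 := by
      rcases mul_eq_zero.mp (show z.re * z.im = 0 by linarith) with h | h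
      · exact h
      · exact absurd h h0
    rw [this] at h1
    have := mul_self_pos.mpr h0
    linarith
  have hθ : (Φ (c 1 : 𝓞 K)).im = 0 := by
    have : z = 2 * Φ (c 1 : 𝓞 K) - (hφ.embedding t : ℂ) := by
      rw [hz, ← hrealO, ← map_ofNat Φ 2, ← map_mul, ← map_sub]; push_cast; rfl
    rw [this] at him
    simpa only [Complex.sub_im, Complex.mul_im, Complex.ofReal_im, Complex.re_ofNat, Complex.im_ofNat,
      zero_mul, add_zero, sub_zero, mul_eq_zero, OfNat.ofNat_ne_zero, false_or] using him
  refine IsTotallyComplex.complexEmbedding_not_isReal Φ ?_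
  rw [ComplexEmbedding.isReal_iff]
  refine IsLocalization.ringHom_ext (nonZeroDivisors (𝓞 K)) ?_
  ext x
  rw [← c.sum_repr x, Fin.sum_univ_two, hc]
  simp only [Algebra.smul_def, mul_one, RingHom.comp_apply, ComplexEmbedding.conjugate_coe_eq]
  rw [map_add, map_mul, map_add, map_mul, hrealO, hrealO, map_add, map_mul, Complex.conj_ofReal,
    Complex.conj_ofReal, Complex.conj_eq_iff_im.mpr hθ]

theorem le_discr_of_isTotallyReal_of_isTotallyComplex [IsTotallyReal F] [IsTotallyComplex K]
    (hF : finrank ℚ F = 2) (hK : finrank F K = 2) : 125 ≤ discr K := by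
  have hK4 : finrank ℚ K = 4 := by rw [← finrank_mul_finrank ℚ F K, hF, hK]
  have hpos := discr_pos_of_isTotallyComplex hK4
  have hDpos := discr_pos_of_isTotallyReal F
  obtain ⟨b, m, s, hb0, hb1, hs, hD⟩ := exists_basis_ringOfIntegers_of_finrank_eq_two hF
  by_cases hD12 : 12 ≤ discr F
  · have := Int.le_of_dvd hpos (discr_sq_dvd_discr_of_finrank_eq_two (F := F) hK)
    nlinarith
  have := isPrincipalIdealRing_of_finrank_eq_two hF (by omega)
  -- Values `s² + 4m` with `s ∈ {0, 1}` in `(0, 12)` are 1, 4, 5, 8, 9; excluding squares leaves 5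
  -- and 8.
  have h1 := discr_ne_sq_of_finrank_eq_two hF 1
  have h2 := discr_ne_sq_of_finrank_eq_two hF 2
  have h3 := discr_ne_sq_of_finrank_eq_two hF 3
  obtain ⟨c, hc0⟩ := exists_basis_fin_two_zero_eq_one (𝓞 F) (𝓞 K)
    (by rw [← IsFractionRing.finrank_eq (𝓞 F) F (𝓞 K) K, hK])
  obtain ⟨p, t, hc1⟩ := c.exists_sq_eq hc0
  obtain ⟨φ, hφ⟩ := exists_embedding_relative_discr_neg hc0 hc1
  have hrepr (x : 𝓞 F) : x = b.repr x 0 • 1 + b.repr x 1 • b 1 := by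
    conv_lhs => rw [← b.sum_repr x, Fin.sum_univ_two, hb0]
  obtain ⟨p₀, p₁, rfl⟩ : ∃ x y : ℤ, p = x • 1 + y • b 1 := ⟨_, _, hrepr p⟩
  obtain ⟨t₀, t₁, rfl⟩ : ∃ x y : ℤ, t = x • 1 + y • b 1 := ⟨_, _, hrepr t⟩
  obtain ⟨u, hu⟩ : ∃ u, u = t₀ ^ 2 + m * t₁ ^ 2 + 4 * p₀ := ⟨_, rfl⟩
  obtain ⟨v, hv⟩ : ∃ v, v = 2 * t₀ * t₁ + s * t₁ ^ 2 + 4 * p₁ := ⟨_, rfl⟩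
  have hdiscr := Module.Basis.discr_smulTower_of_sq_eq hb0 hc0 hb1 hc1 hu hv
  rw [discr_eq_discr K, ← hD] at hdiscr
  rcases hs with rfl | rfl
  · obtain rfl : m = 2 := by omega
    have hD8 : discr F = 8 := by omega
    rw [hD8] at hdiscr
    by_contra! hlt
    have hN : u ^ 2 - 2 * v ^ 2 = 1 := by
      have : discr K = 64 * (u ^ 2 - 2 * v ^ 2) := by rw [hdiscr]; ring
      omega
    simp only [zsmul_eq_mul, mul_one, Int.cast_zero, zero_mul, add_zero,
      Int.cast_ofNat] at hb1 hφ
    have hr : φ (b 1 : 𝓞 F) ^ 2 = 2 := by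
      rw [← map_pow]
      have : (b 1 : F) ^ 2 = 2 := congrArg (fun x : 𝓞 F => (x : F)) hb1
      rw [this, map_ofNat]
    have hneg : (u : ℝ) + v * φ (b 1 : 𝓞 F) < 0 := by
      refine lt_of_eq_of_lt ?_ hφ
      rw [hu, hv]
      push_cast [map_add, map_mul, map_pow, map_intCast, map_ofNat]
      linear_combination (-(t₁ : ℝ) ^ 2) * hr
    -- Positive norm gives `δ` the same sign at both real places, so half its trace, `u`, is
    -- negative.
    have hu0 : u < 0 := by
      by_contra! hu0
      have hu0' : (0 : ℝ) ≤ u := by exact_mod_cast hu0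
      have hN' : (u : ℝ) ^ 2 - 2 * v ^ 2 = 1 := by exact_mod_cast hN
      nlinarith
    exact not_square_mod_four_of_neg_of_norm_eq_one _ u v le_rfl hu0 hN
      (sq_add_two_mul_sq_mod_four hu (by simpa using hv) hN)
  · obtain rfl : m = 1 := by omega
    have hD5 : discr F = 5 := by omega
    rw [hD5] at hdiscr
    by_contra! hlt
    have h43 := forty_three_lt_discr_of_isTotallyComplex hK4
    have : discr K = 25 * (u ^ 2 + u * v - v ^ 2) := by rw [hdiscr]; ring
    exact norm_golden_notMem_Icc (by simpa using hu) (by simpa using hv) ⟨by omega, by omega⟩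

end CM


/-! ### The fifth cyclotomic field -/

section CyclotomicFive

variable (K : Type*) [Field K] [NumberField K] [IsCyclotomicExtension {5} ℚ K]

variable {K} in
theorem IsCMField.not_isCMField_subfield_of_isCyclotomicExtension_five
    (F : Subfield K) (hF : F ≠ ⊤) : ¬ IsCMField F := by
  intro hCM
  have : IsCMField K :=
    IsCyclotomicExtension.Rat.isCMField (S := {5}) _ ⟨5, rfl, by norm_num⟩
  have : IsGalois ℚ K := IsCyclotomicExtension.isGalois {5} ℚ _
  let f := IsCyclotomicExtension.Rat.galEquivZMod 5 K
  let L : IntermediateField ℚ K := F.toIntermediateField fun q => by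
    rw [eq_ratCast]; exact SubfieldClass.ratCast_mem F q
  let κ : Gal(K/ℚ) := (IsCMField.complexConj K).restrictScalars ℚ
  have hκ1 : κ ≠ 1 := fun h => IsCMField.complexConj_ne_one K <|
    AlgEquiv.ext fun x => AlgEquiv.congr_fun h x
  have hκ2 : κ ^ 2 = 1 := AlgEquiv.ext fun x => by
    simp [sq, κ]
  have hL : L.fixingSubgroup ≠ ⊥ := by
    intro h
    apply hF
    have : L = ⊤ := by
      rw [← IsGalois.fixedField_fixingSubgroup L, h, IntermediateField.fixedField_bot]
    ext x
    exact ⟨fun _ => trivial, fun _ => (this ▸ IntermediateField.mem_top : x ∈ L)⟩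
  obtain ⟨σ, hσ, hσ1⟩ := L.fixingSubgroup.bot_or_exists_ne_one.resolve_left hL
  -- In the cyclic group of order 4, the unique involution is a power of every nontrivial element.
  have hZ : ∀ g c : (ZMod 5)ˣ, g ≠ 1 → c ≠ 1 → c ^ 2 = 1 → c = g ∨ c = g ^ 2 := by decide
  have hκL : κ ∈ L.fixingSubgroup := by
    rcases hZ (f σ) (f κ) (by simpa using hσ1) (by simpa using hκ1)
      (by rw [← map_pow, hκ2, map_one]) with h | h
    · rwa [f.injective h]
    · rw [← map_pow] at h
      rw [f.injective h]
      exact pow_mem hσ 2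
  -- Being fixed by conjugation, `F` is totally real, whereas a CM field is totally complex.
  have hle : F ≤ maximalRealSubfield K := fun x hx =>
    (IsCMField.complexConj_eq_self_iff K x).mp
      ((IntermediateField.mem_fixingSubgroup_iff L κ).mp hκL x hx)
  have := isTotallyReal_iff_le_maximalRealSubfield.mpr hle
  obtain ⟨w⟩ : Nonempty (InfinitePlace F) := inferInstance
  exact InfinitePlace.not_isReal_iff_isComplex.mpr (IsTotallyComplex.isComplex w)
    (IsTotallyReal.isReal w)

theorem isPrimitiveQuarticCMField_of_isCyclotomicExtension_five :
    IsPrimitiveQuarticCMField K where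
  isPrimitiveCMField :=
    { isCMField := IsCyclotomicExtension.Rat.isCMField (S := {5}) _ ⟨5, rfl, by norm_num⟩
      not_isCMField_of_ne_top := IsCMField.not_isCMField_subfield_of_isCyclotomicExtension_five }
  finrank_eq_four := by
    rw [IsCyclotomicExtension.finrank (n := 5) _
      (Polynomial.cyclotomic.irreducible_rat (by norm_num))]
    decide

theorem discr_of_isCyclotomicExtension_five : discr K = 125 := by
  have : Fact (Nat.Prime 5) := ⟨by norm_num⟩
  rw [IsCyclotomicExtension.Rat.discr_prime 5 K]
  norm_num

end CyclotomicFive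

/-- `CyclotomicField n ℚ` is a cyclotomic extension for the canonical `ℚ`-algebra structure. -/
theorem isCyclotomicExtension_rat_cyclotomicField (n : ℕ) :
    @IsCyclotomicExtension {n} ℚ (CyclotomicField n ℚ) _ _ DivisionRing.toRatAlgebra := by
  rw [Subsingleton.elim (DivisionRing.toRatAlgebra : Algebra ℚ (CyclotomicField n ℚ))
    (CyclotomicField.algebra n ℚ)]
  infer_instance

theorem _root_.IsPrimitiveQuarticCMField.le_discr {K : Type*} [Field K] [NumberField K]
    (h : IsPrimitiveQuarticCMField K) : 125 ≤ discr K := by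
  have := h.isPrimitiveCMField.isCMField
  have h2 : finrank (maximalRealSubfield K) K = 2 :=
    Algebra.IsQuadraticExtension.finrank_eq_two _ _
  have h4 := finrank_mul_finrank ℚ (maximalRealSubfield K) K
  rw [h2, h.finrank_eq_four] at h4
  exact le_discr_of_isTotallyReal_of_isTotallyComplex (F := maximalRealSubfield K) (by omega) h2

end NumberField

theorem lemmal :
    (∀ (K : Type*) [Field K] [NumberField K],
      IsPrimitiveQuarticCMField K → 125 ≤ NumberField.discr K) ∧
    IsPrimitiveQuarticCMField (CyclotomicField 5 ℚ) ∧
      NumberField.discr (CyclotomicField 5 ℚ) = 125 := by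
  have := NumberField.isCyclotomicExtension_rat_cyclotomicField 5
  exact ⟨fun _ _ _ h => h.le_discr,
    NumberField.isPrimitiveQuarticCMField_of_isCyclotomicExtension_five _,
    NumberField.discr_of_isCyclotomicExtension_five _⟩
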